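/- \textbf{Notation.} A $d\times d$ integer matrix is a \emph{dilation matrix} if all its eigenvalues are greater than $1$ in modulus. Write $(l_0(\mathbb Z^d))^{t\times r}$ for the finitely supported sequences (filters) $b:\mathbb Z^d\to\mathbb C^{t\times r}$, $\widehat b(\xi)=\sum_k b(k)e^{-ik\cdot\xi}$, and $\widehat f(\xi)=\int f(x)e^{-ix\cdot\xi}\,dx$, extended to $L_2(\mathbb R^d)$. For $u:\mathbb Z^d\to\mathbb C^{s\times r}$ and $b\in(l_0(\mathbb Z^d))^{t\times r}$ put $$[\mathcal T_{b,M}u](n)=|\det M|^{1/2}\sum_{k\in\mathbb Z^d}u(k)\overline{b(k-Mn)}^{\mathsf T},\qquad \langle u,b\rangle_{l_2}=\sum_{k}u(k)\overline{b(k)}^{\mathsf T}.$$ For an invertible real matrix $U$ and $y\in\mathbb R^d$ put $f_{U;y}(x)=|\det U|^{1/2}f(Ux-y)$; and for a scalar function $f$ and a column vector $g$ of $L_2$ functions put $\langle f,g\rangle=\int f(x)\overline{g(x)}^{\mathsf T}dx$. Let $b_0\in(l_0(\mathbb Z^d))^{r\times r}$, $b_1,\dots,b_s\in(l_0(\mathbb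 Z^d))^{1\times r}$ be filters and $M_0,\dots,M_s$ dilation matrices. For $j\ge1$ and $0\le l\le s$ let $$b_{l,j}=(b_l\uparrow M_0^{j-1})*(b_0\uparrow M_0^{j-2})*\cdots*(b_0\uparrow M_0)*b_0,\qquad b_{l,j;k}=|\det M_0|^{\frac{j-1}2}|\det M_l|^{\frac12}\,b_{l,j}(\cdot-M_0^{j-1}M_lk),$$ where $(u*v)(n)=\sum_k u(k)v(n-k)$, $(u\uparrow M)(Mm)=u(m)$ and $u\uparrow M=0$ off $M\mathbb Z^d$. The filter bank $\{b_l!M_l\}_{l=0}^s$ \emph{has stability in $l_2(\mathbb Z^d)$} if there are $C_1,C_2>0$ such that for all $J\ge1$ and all $v\in(l_2(\mathbb Z^d))^{1\times r}$ $$C_1\|v\|^2\le \|v_{0,J}\|^2+\sum_{j=1}^J\sum_{l=1}^s\|v_{l,j}\|^2\le C_2\|v\|^2,\qquad v_{0,0}=v,\quad v_{l,j}=\mathcal T_{b_l,M_l}v_{0,j-1}\quad(0\le l\le s).$$ \textbf{Proposition.} Let $\psi^0\in(L_2(\mathbb R^d))^r$ be refinable with filter $b_0$, that is, $$\psi^0(x)=|\det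 M_0|\sum_{k\in\mathbb Z^d}b_0(k)\psi^0(M_0x-k)\quad\text{for a.e. }x$$ (equivalently $\widehat{\psi^0}(M_0^{\mathsf T}\xi)=\widehat{b_0}(\xi)\widehat{\psi^0}(\xi)$), and define $\psi^1,\dots,\psi^s\in L_2(\mathbb R^d)$ by $\widehat{\psi^l}(\xi)=\widehat{b_l}(M_0^{-\mathsf T}\xi)\widehat{\psi^0}(M_0^{-\mathsf T}\xi)$. For $f\in L_2(\mathbb R^d)$ put $$w_{l,j}(k)=\big\langle f,\ |\det(M_0^{-1}M_l)|^{\frac12}\,\psi^l_{M_0^j;M_0^{-1}M_lk}\big\rangle,\qquad k\in\mathbb Z^d,\ 0\le l\le s,\ j\ge0.$$ \begin{enumerate} \item[(i)] $w_{l,j}(k)=[\mathcal T_{b_l,M_l}w_{0,j+1}](k)$ for all $f\in L_2(\mathbb R^d)$, $j\ge0$, $0\le l\le s$, $k\in\mathbb Z^d$. \item[(ii)] $w_{l,j}(k)=\langle w_{0,J},b_{l,J-j;k}\rangle_{l_2}$ for all $f\in L_2(\mathbb R^d)$, $J>j\ge0$, $0\le l\le s$, $k\in\mathbb Z^d$.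 \item[(iii)] If moreover $\psi^0$ is compactly supported and $\{b_l!M_l\}_{l=0}^s$ has stability in $l_2(\mathbb Z^d)$, then the affine system $$\{\psi^0_q(\cdot-k):1\le q\le r,\ k\in\mathbb Z^d\}\cup\{|\det(M_0^{-1}M_l)|^{\frac12}\psi^l_{M_0^j;M_0^{-1}M_lk}:1\le l\le s,\ j\ge0,\ k\in\mathbb Z^d\}$$ is a Bessel sequence in $L_2(\mathbb R^d)$: its elements $e$ (indexed by $(q,k)$ and $(l,j,k)$) satisfy $\sum_e|\langle f,e\rangle|^2\le C\|f\|^2$ for all $f\in L_2(\mathbb R^d)$, with a constant $C>0$ independent of $f$. \end{enumerate} -/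

import Mathlib

open MeasureTheory Matrix
open scoped FourierTransform ENNReal ComplexConjugate

noncomputable section

namespace MixedFramelet

/-! ### Sequences, filters and the discrete framelet transform -/

/-- The integer lattice `ℤ^d`. -/
abbrev Lat (d : ℕ) := Fin d → ℤ

/-- All sequences on `ℤ^d` with values in the complex `t × r` matrices. -/
abbrev MSeq (d t r : ℕ) := Lat d → Matrix (Fin t) (Fin r) ℂ

/-- The finitely supported ones: the filters. -/
abbrev MFilter (d t r : ℕ) := Lat d →₀ Matrix (Fin t) (Fin r) ℂ

/-- An integer matrix all of whose (complex) eigenvalues are greater than one in modulus. -/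
def IsDilation {d : ℕ} (M : Matrix (Fin d) (Fin d) ℤ) : Prop :=
  ∀ z : ℂ, Module.End.HasEigenvalue (Matrix.toLin' (M.map (Int.cast : ℤ → ℂ))) z → 1 < ‖z‖

/-- `|det M|` as a real number. -/
def absDet {d : ℕ} (M : Matrix (Fin d) (Fin d) ℤ) : ℝ := |(M.det : ℝ)|

/-- The transition operator
`[T_{b,M} u](n) = |det M|^{1/2} ∑_k u(k) (conj b(k - M n))ᵀ` (a finite sum). -/
def transition {d s t r : ℕ} (b : MFilter d t r) (M : Matrix (Fin d) (Fin d) ℤ)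
    (u : MSeq d s r) : MSeq d s t :=
  fun n => (Real.sqrt (absDet M) : ℂ) • ∑ᶠ k : Lat d, u k * (b (k - M *ᵥ n))ᴴ

/-- Convolution `(u₁ * u₂)(n) = ∑_k u₁(k) u₂(n - k)`; only used for finitely supported sequences. -/
def conv {d s t r : ℕ} (u₁ : MSeq d s t) (u₂ : MSeq d t r) : MSeq d s r :=
  fun n => ∑ᶠ k : Lat d, u₁ k * u₂ (n - k)

open Classical in
/-- Upsampling: `(u ↑ M)(M m) = u(m)`, and `(u ↑ M)(k) = 0` if `k ∉ M ℤ^d`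
(for `M` with nonzero determinant, so that `m` is unique). -/
def upsample {d t r : ℕ} (u : MSeq d t r) (M : Matrix (Fin d) (Fin d) ℤ) : MSeq d t r :=
  fun k => if h : ∃ m : Lat d, M *ᵥ m = k then u h.choose else 0

/-- The sequence `δ I_r`. -/
def deltaSeq (d r : ℕ) : MSeq d r r := fun k => if k = 0 then 1 else 0

/-- `b_{0,j} = (b₀ ↑ M₀^{j-1}) * ⋯ * (b₀ ↑ M₀) * b₀`, with `b_{0,0} = δ I_r`. -/
def lowpassFilter {d r : ℕ} (M₀ : Matrix (Fin d) (Fin d) ℤ) (b₀ : MFilter d r r) : ℕ → MSeq d r r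
  | 0 => deltaSeq d r
  | j + 1 => conv (upsample b₀ (M₀ ^ j)) (lowpassFilter M₀ b₀ j)

/-- `b_{l,j} = (b_l ↑ M₀^{j-1}) * (b₀ ↑ M₀^{j-2}) * ⋯ * (b₀ ↑ M₀) * b₀`, where `b = b_l`
and `j ≥ 1`. -/
def levelFilter {d t r : ℕ} (M₀ : Matrix (Fin d) (Fin d) ℤ) (b₀ : MFilter d r r)
    (b : MFilter d t r) (j : ℕ) : MSeq d t r :=
  conv (upsample b (M₀ ^ (j - 1))) (lowpassFilter M₀ b₀ (j - 1))

/-- `b_{l,j;k} = |det M₀|^{(j-1)/2} |det M_l|^{1/2} b_{l,j}(· - M₀^{j-1} M_l k)`, where `b = b_l`,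
`M = M_l` and `j ≥ 1`. -/
def discreteAtom {d t r : ℕ} (M₀ : Matrix (Fin d) (Fin d) ℤ) (b₀ : MFilter d r r)
    (M : Matrix (Fin d) (Fin d) ℤ) (b : MFilter d t r) (j : ℕ) (k : Lat d) : MSeq d t r :=
  fun n => (Real.sqrt (absDet M₀) ^ (j - 1) * Real.sqrt (absDet M) : ℂ) •
    levelFilter M₀ b₀ b j (n - (M₀ ^ (j - 1) * M) *ᵥ k)

/-- `⟨u, v⟩ = ∑_k u(k) (conj v(k))ᵀ`, a matrix. -/
def seqInner {d s t r : ℕ} (u : MSeq d s r) (v : MSeq d t r) : Matrix (Fin s) (Fin t) ℂ :=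
  ∑' k : Lat d, u k * (v k)ᴴ

/-- The squared `ℓ²` norm, in `[0, ∞]`. -/
def seqNormSq {d t r : ℕ} (u : MSeq d t r) : ℝ≥0∞ := ∑' k : Lat d, ∑ p, ∑ q, ‖u k p q‖ₑ ^ 2

/-- `v_{0,j}` in the discrete framelet decomposition: `v_{0,0} = v`,
`v_{0,j} = T_{b₀,M₀} v_{0,j-1}`. -/
def lowpassData {d r : ℕ} (M₀ : Matrix (Fin d) (Fin d) ℤ) (b₀ : MFilter d r r) (v : MSeq d 1 r) :
    ℕ → MSeq d 1 r
  | 0 => v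
  | j + 1 => transition b₀ M₀ (lowpassData M₀ b₀ v j)

/-- The `J`-level discrete framelet analysis operator
`W_J v = ((v_{l,j})_{1 ≤ j ≤ J, 1 ≤ l ≤ s}, v_{0,J})`, where `v_{l,j} = T_{b_l,M_l} v_{0,j-1}`;
the entry with index `j : Fin J` is `v_{l,j+1}`. -/
def analysis {d r s : ℕ} (M₀ : Matrix (Fin d) (Fin d) ℤ) (M : Fin s → Matrix (Fin d) (Fin d) ℤ)
    (b₀ : MFilter d r r) (b : Fin s → MFilter d 1 r) (J : ℕ) (v : MSeq d 1 r) :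
    (Fin J → Fin s → MSeq d 1 1) × MSeq d 1 r :=
  (fun j l => transition (b l) (M l) (lowpassData M₀ b₀ v j), lowpassData M₀ b₀ v J)

/-- The squared `ℓ²` norm of a tuple of sequences such as `W_J v`. -/
def tupleNormSq {d r s J : ℕ} (w : (Fin J → Fin s → MSeq d 1 1) × MSeq d 1 r) : ℝ≥0∞ :=
  (∑ j, ∑ l, seqNormSq (w.1 j l)) + seqNormSq w.2

/-- The filter bank `{b_l ! M_l}_{l=0}^s` has stability in `ℓ²`: for some `C₁, C₂ > 0`,
`C₁ ‖v‖² ≤ ‖W_J v‖² ≤ C₂ ‖v‖²` for all `J ≥ 1` and all `v` in `ℓ²`. -/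
def HasStability {d r s : ℕ} (M₀ : Matrix (Fin d) (Fin d) ℤ)
    (M : Fin s → Matrix (Fin d) (Fin d) ℤ) (b₀ : MFilter d r r) (b : Fin s → MFilter d 1 r) :
    Prop :=
  ∃ C₁ C₂ : ℝ, 0 < C₁ ∧ 0 < C₂ ∧ ∀ J : ℕ, 1 ≤ J → ∀ v : MSeq d 1 r, seqNormSq v < ∞ →
    ENNReal.ofReal C₁ * seqNormSq v ≤ tupleNormSq (analysis M₀ M b₀ b J v) ∧
    tupleNormSq (analysis M₀ M b₀ b J v) ≤ ENNReal.ofReal C₂ * seqNormSq v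

/-! ### Functions on `ℝ^d` -/

/-- `ℝ^d`. -/
abbrev Euc (d : ℕ) := EuclideanSpace ℝ (Fin d)

/-- `L₂(ℝ^d)`. -/
abbrev L2 (d : ℕ) := Lp ℂ 2 (volume : Measure (Euc d))

/-- An integer matrix as a real one. -/
def realMat {d : ℕ} (M : Matrix (Fin d) (Fin d) ℤ) : Matrix (Fin d) (Fin d) ℝ :=
  M.map (Int.cast : ℤ → ℝ)

/-- An integer vector as a point of `ℝ^d`. -/
def latPt {d : ℕ} (k : Lat d) : Euc d := WithLp.toLp 2 fun i => (k i : ℝ)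

/-- The matrix-vector product `A x` in `ℝ^d`. -/
def act {d : ℕ} (A : Matrix (Fin d) (Fin d) ℝ) (x : Euc d) : Euc d := Matrix.toEuclideanLin A x

/-- The Fourier series `∑_k b(k) e^{-i k·ξ}` of a filter. -/
def symbol {d t r : ℕ} (b : MFilter d t r) (ξ : Euc d) : Matrix (Fin t) (Fin r) ℂ :=
  b.sum fun k B => Complex.exp (-Complex.I * ∑ i, (k i : ℂ) * (ξ i : ℂ)) • B

/-- The Fourier transform on `L₂(ℝ^d)` that extends `ξ ↦ ∫ f(x) e^{-i x·ξ} dx`. The one in Mathlib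
extends `ξ ↦ ∫ f(x) e^{-2πi x·ξ} dx`. -/
def fourierL2 {d : ℕ} (f : L2 d) : Euc d → ℂ :=
  fun ξ => (𝓕 f : L2 d) ((2 * Real.pi)⁻¹ • ξ)

/-- The entry with index `p` of the vector `b̂(M₀^{-T} ξ) φ̂(M₀^{-T} ξ)`. -/
def maskedFourier {d t r : ℕ} (M₀ : Matrix (Fin d) (Fin d) ℤ) (b : MFilter d t r)
    (φ : Fin r → L2 d) (p : Fin t) (ξ : Euc d) : ℂ :=
  (symbol b (act ((realMat M₀)⁻¹)ᵀ ξ) *ᵥ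
    fun q => fourierL2 (φ q) (act ((realMat M₀)⁻¹)ᵀ ξ)) p

theorem IsDilation.det_ne_zero {d : ℕ} {M : Matrix (Fin d) (Fin d) ℤ} (hM : IsDilation M) :
    M.det ≠ 0 := by
  intro h
  have h1 : (M.map (Int.cast : ℤ → ℂ)).det = 0 := by
    have := (Int.castRingHom ℂ).map_det M
    simp only [h, map_zero] at this
    exact this.symm
  obtain ⟨v, hv, hv0⟩ := Matrix.exists_mulVec_eq_zero_iff.mpr h1
  have : Module.End.HasEigenvalue (Matrix.toLin' (M.map (Int.cast : ℤ → ℂ))) 0 :=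
    Module.End.hasEigenvalue_of_hasEigenvector (x := v)
      ⟨by simp [hv0], hv⟩
  have := hM 0 this
  simp at this
  linarith

theorem memLp_comp_linear {d : ℕ} {f : Euc d → ℂ} (hf : MemLp f 2 volume)
    (A : Euc d →ₗ[ℝ] Euc d) (hA : LinearMap.det A ≠ 0) :
    MemLp (fun x => f (A x)) 2 volume := by
  refine MemLp.comp_of_map (f := A) (g := f) ?_
    (A.continuous_of_finiteDimensional.measurable.aemeasurable)
  rw [Measure.map_linearMap_addHaar_eq_smul_addHaar volume hA]
  exact hf.smul_measure ENNReal.ofReal_ne_top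

theorem continuous_symbol {d t r : ℕ} (b : MFilter d t r) (p : Fin t) (q : Fin r) :
    Continuous fun ξ => symbol b ξ p q := by
  simp only [symbol, Finsupp.sum, Matrix.sum_apply, Matrix.smul_apply, smul_eq_mul]
  fun_prop

theorem norm_symbol_le {d t r : ℕ} (b : MFilter d t r) (p : Fin t) (q : Fin r) (ξ : Euc d) :
    ‖symbol b ξ p q‖ ≤ ∑ k ∈ b.support, ‖b k p q‖ := by
  simp only [symbol, Finsupp.sum, Matrix.sum_apply, Matrix.smul_apply, smul_eq_mul]
  refine (norm_sum_le _ _).trans (Finset.sum_le_sum fun k _ => ?_)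
  rw [norm_mul, Complex.norm_exp]
  have : (-Complex.I * ∑ i, (k i : ℂ) * (ξ i : ℂ)).re = 0 := by
    have h : (∑ i, (k i : ℂ) * (ξ i : ℂ)) = ((∑ i, (k i : ℝ) * ξ i : ℝ) : ℂ) := by push_cast; rfl
    rw [h]; simp
  rw [this]; simp

theorem memLp_maskedFourier {d t r : ℕ} {M₀ : Matrix (Fin d) (Fin d) ℤ} (hM₀ : IsDilation M₀)
    (b : MFilter d t r) (φ : Fin r → L2 d) (p : Fin t) :
    MemLp (fun η => maskedFourier M₀ b φ p ((2 * Real.pi) • η)) 2 volume := by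
  simp only [maskedFourier, Matrix.mulVec, dotProduct, fourierL2, act, ← map_smul]
  refine memLp_finsetSum _ fun q _ => ?_
  have hdet : LinearMap.det (Matrix.toEuclideanLin ((realMat M₀)⁻¹)ᵀ) ≠ 0 := by
    rw [Matrix.toEuclideanLin_eq_toLin, LinearMap.det_toLin, Matrix.det_transpose]
    have : (realMat M₀).det ≠ 0 := by
      have h := (Int.castRingHom ℝ).map_det M₀
      have h' : (realMat M₀).det = (M₀.det : ℝ) := h.symm
      rw [h']; exact_mod_cast hM₀.det_ne_zero
    simpa [Matrix.det_nonsing_inv, Ring.inverse_eq_inv'] using this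
  have h1 := memLp_comp_linear (Lp.memLp (𝓕 (φ q) : L2 d)) _ hdet
  have h2 : ∀ η : Euc d, (2 * Real.pi)⁻¹ • (2 * Real.pi) • η = η := fun η => by
    rw [smul_smul, inv_mul_cancel₀ (by positivity), one_smul]
  have hc : Continuous fun η : Euc d =>
      symbol b (Matrix.toEuclideanLin ((realMat M₀)⁻¹)ᵀ ((2 * Real.pi) • η)) p q :=
    (continuous_symbol b p q).comp
      ((LinearMap.continuous_of_finiteDimensional _).comp (continuous_const_smul _))
  simp only [h2]
  refine h1.of_le_mul (c := ∑ k ∈ b.support, ‖b k p q‖)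
    (hc.aestronglyMeasurable.mul h1.aestronglyMeasurable) (Filter.Eventually.of_forall fun η => ?_)
  rw [norm_mul]
  exact mul_le_mul_of_nonneg_right (norm_symbol_le b p q _) (norm_nonneg _)

/-- For a mask `b` and a vector `φ` of functions in `L₂(ℝ^d)`, the vector `ψ` of functions in
`L₂(ℝ^d)` that is defined by `ψ̂(ξ) = b̂(M₀^{-T} ξ) φ̂(M₀^{-T} ξ)`. -/
def generator {d t r : ℕ} {M₀ : Matrix (Fin d) (Fin d) ℤ} (hM₀ : IsDilation M₀)
    (b : MFilter d t r) (φ : Fin r → L2 d) (p : Fin t) : L2 d :=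
  𝓕⁻ ((memLp_maskedFourier hM₀ b φ p).toLp)

/-- The Fourier transform of `generator` is the one that it should have. -/
theorem fourierL2_generator {d t r : ℕ} {M₀ : Matrix (Fin d) (Fin d) ℤ} (hM₀ : IsDilation M₀)
    (b : MFilter d t r) (φ : Fin r → L2 d) (p : Fin t) :
    fourierL2 (generator hM₀ b φ p) =ᵐ[volume] maskedFourier M₀ b φ p := by
  have h := (memLp_maskedFourier hM₀ b φ p).coeFn_toLp
  have hq : Measure.QuasiMeasurePreserving (fun ξ : Euc d => (2 * Real.pi)⁻¹ • ξ)
      volume volume := by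
    refine ⟨measurable_const_smul _, ?_⟩
    rw [Measure.map_addHaar_smul volume (by positivity)]
    exact Measure.smul_absolutelyContinuous
  filter_upwards [hq.ae h] with ξ hξ
  simp only [fourierL2, generator, FourierTransform.fourier_fourierInv_eq]
  rw [hξ, smul_smul, mul_inv_cancel₀ (by positivity), one_smul]

/-- `φ` is refinable with filter `b₀` and dilation matrix `M₀`:
`φ(x) = |det M₀| ∑_k b₀(k) φ(M₀ x - k)` for almost every `x`. -/
def IsRefinable {d r : ℕ} (M₀ : Matrix (Fin d) (Fin d) ℤ) (b₀ : MFilter d r r)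
    (φ : Fin r → L2 d) : Prop :=
  ∀ᵐ x : Euc d, (fun p => φ p x) =
    (absDet M₀ : ℂ) • b₀.sum fun k B => B *ᵥ fun q => φ q (act (realMat M₀) x - latPt k)

/-- All entries of `φ` vanish almost everywhere outside one compact set. -/
def IsCompactlySupported {d r : ℕ} (φ : Fin r → L2 d) : Prop :=
  ∃ K : Set (Euc d), IsCompact K ∧ ∀ q, ∀ᵐ x : Euc d, x ∉ K → φ q x = 0

/-- `f_{U;y}(x) = |det U|^{1/2} f(U x - y)`. -/
def dilate {d : ℕ} (U : Matrix (Fin d) (Fin d) ℝ) (y : Euc d) (f : Euc d → ℂ) : Euc d → ℂ :=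
  fun x => (Real.sqrt |U.det| : ℂ) * f (act U x - y)

/-- `|det (M₀⁻¹ M)|^{1/2} g_{M₀^j; M₀⁻¹ M k}`. -/
def affineAtom {d : ℕ} (M₀ M : Matrix (Fin d) (Fin d) ℤ) (g : Euc d → ℂ) (j : ℕ) (k : Lat d) :
    Euc d → ℂ :=
  fun x => (Real.sqrt |((realMat M₀)⁻¹ * realMat M).det| : ℂ) *
    dilate (realMat M₀ ^ j) (act ((realMat M₀)⁻¹ * realMat M) (latPt k)) g x

/-- `⟨f, g⟩ = ∫ f(x) conj (g(x)) dx`. -/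
def pairing {d : ℕ} (f g : Euc d → ℂ) : ℂ := ∫ x, f x * conj (g x)

/-- The coefficients `w_{l,j}(k) = ⟨f, |det (M₀⁻¹ M_l)|^{1/2} ψ^l_{M₀^j; M₀⁻¹ M_l k}⟩`, a row
vector, where `M = M_l` and `ψ = ψ^l` is a column vector. -/
def affineCoeff {d t : ℕ} (M₀ M : Matrix (Fin d) (Fin d) ℤ) (ψ : Fin t → L2 d) (f : L2 d) (j : ℕ) :
    MSeq d 1 t :=
  fun k => Matrix.of fun _ q => pairing f (affineAtom M₀ M (ψ q) j k)

/-- The affine system with mixed dilation factors, as a family: `ψ⁰_q(· - k)` for `q < r` and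
`k ∈ ℤ^d`, and `|det (M₀⁻¹ M_l)|^{1/2} ψ^l_{M₀^j; M₀⁻¹ M_l k}` for `l`, `j ≥ 0` and `k ∈ ℤ^d`. -/
def affineSystem {d r s : ℕ} (M₀ : Matrix (Fin d) (Fin d) ℤ)
    (M : Fin s → Matrix (Fin d) (Fin d) ℤ) (ψ₀ : Fin r → L2 d) (ψ : Fin s → Fin 1 → L2 d) :
    (Fin r × Lat d) ⊕ (Fin s × ℕ × Lat d) → Euc d → ℂ
  | .inl (q, k) => fun x => ψ₀ q (x - latPt k)
  | .inr (l, j, k) => affineAtom M₀ (M l) (ψ l 0) j k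

/-- A family in `L₂(ℝ^d)` is a Bessel sequence: for some `C > 0`,
`∑_i |⟨f, e_i⟩|² ≤ C ‖f‖²` for all `f`. -/
def IsBessel {d : ℕ} {ι : Type*} (e : ι → Euc d → ℂ) : Prop :=
  (∀ i, MemLp (e i) 2 volume) ∧ ∃ C : ℝ, 0 < C ∧ ∀ f : L2 d,
    ∑' i, ‖pairing f (e i)‖ₑ ^ 2 ≤ ENNReal.ofReal (C * ‖f‖ ^ 2)

end MixedFramelet

end

/-!
All three assertions rest on one relation in the space domain, `TwoScale`: the vector `g` satisfies
`g(x) = |det M₀| ∑_k b(k) φ(M₀ x - k)` almost everywhere. For `φ = g = ψ⁰` it is refinability. For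
`g = ψ^l`, which is defined through its Fourier transform, it is `twoScale_generator`: the `L₂`
Fourier transform turns `f(A x - y)` into `|det A|⁻¹ e^{-2πi A⁻¹y·ξ} f̂(A⁻ᵀ ξ)`
(`fourier_affinePullback`, by density of the Schwartz functions), so that the right-hand side of the
relation has the prescribed Fourier transform, and the Fourier transform is injective.

Pairing `f` with the dilated and translated two-scale relation expresses the coefficients at level
`j` through the low-pass coefficients at level `j + 1`, by the transition operator. This is
`TwoScale.affineCoeff_eq`, the first assertion.

For the second, the relation for `b₀` is iterated. A sequence of correlations
`∑_k u(k) a(k - N n)*`, put through the transition operator of `b` and `M`, becomes a sequence of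
correlations with `(b ↑ N) * a` on the lattice `N M ℤ^d` (`transition_correlation`), and this is
the recursion that defines the filters `b_{l,j}`.

For the third, let `w_J` be the low-pass coefficients of `f` at level `J`. When `ψ⁰` has compact
support, the supports of `ψ⁰(M₀^J x - k)`, `k ∈ ℤ^d`, overlap boundedly often, uniformly in `J`;
with the Cauchy–Schwarz inequality this gives `‖w_J‖² ≤ B ‖f‖²` with `B` independent of `J`
(`tsum_enorm_pairing_affineAtom_le`). By the first assertion the `J`-level discrete framelet
transform of `w_J` consists of `w_0` and of the coefficients of `f` against `ψ^l` at the levels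
`0, …, J - 1` (`tupleNormSq_analysis`). Stability bounds their total energy by `C₂ B ‖f‖²`, and
`J → ∞` gives the Bessel bound.
-/

namespace MixedFramelet

/-! ### Affine changes of variables and the Fourier transform on `L₂` -/

theorem continuous_act {d : ℕ} (A : Matrix (Fin d) (Fin d) ℝ) : Continuous (act A) :=
  LinearMap.continuous_of_finiteDimensional _

theorem act_mul {d : ℕ} (A B : Matrix (Fin d) (Fin d) ℝ) (x : Euc d) :
    act (A * B) x = act A (act B x) := by
  simp [act]

theorem act_one {d : ℕ} (x : Euc d) : act 1 x = x := by
  simp [act]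

theorem inner_act_left {d : ℕ} (A : Matrix (Fin d) (Fin d) ℝ) (x y : Euc d) :
    inner ℝ (act A x) y = inner ℝ x (act Aᵀ y) := by
  simp only [act, Matrix.toLpLin_apply, PiLp.inner_apply, RCLike.inner_apply, conj_trivial]
  simp only [mulVec, dotProduct, Finset.mul_sum, Finset.sum_mul, Matrix.transpose_apply]
  rw [Finset.sum_comm]
  exact Finset.sum_congr rfl fun i _ => Finset.sum_congr rfl fun j _ => by ring

theorem det_toEuclideanLin {d : ℕ} (A : Matrix (Fin d) (Fin d) ℝ) :
    LinearMap.det (Matrix.toEuclideanLin A) = A.det := by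
  have h : Matrix.toEuclideanLin A = Matrix.toLin (PiLp.basisFun 2 ℝ (Fin d))
      (PiLp.basisFun 2 ℝ (Fin d)) A := by
    rw [← Matrix.toLpLin_eq_toLin]
  rw [h, LinearMap.det_toLin]

theorem map_affine_volume {d : ℕ} {A : Matrix (Fin d) (Fin d) ℝ} (hA : A.det ≠ 0) (y : Euc d) :
    Measure.map (fun x => act A x - y) volume = ENNReal.ofReal |A.det|⁻¹ • volume := by
  have h1 : Measure.map (act A) volume = ENNReal.ofReal |A.det|⁻¹ • volume := by
    have h := Measure.map_linearMap_addHaar_eq_smul_addHaar (volume : Measure (Euc d))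
      (f := Matrix.toEuclideanLin A) (by rwa [det_toEuclideanLin])
    rw [det_toEuclideanLin, abs_inv] at h
    exact h
  have h2 : (fun x => act A x - y) = (fun x => x - y) ∘ act A := rfl
  rw [h2, ← Measure.map_map (measurable_sub_const y) (continuous_act A).measurable, h1,
    Measure.map_smul, (measurePreserving_sub_right volume y).map_eq]

theorem measurable_affine {d : ℕ} (A : Matrix (Fin d) (Fin d) ℝ) (y : Euc d) :
    Measurable fun x => act A x - y :=
  ((continuous_act A).sub continuous_const).measurable

theorem quasiMeasurePreserving_affine {d : ℕ} {A : Matrix (Fin d) (Fin d) ℝ} (hA : A.det ≠ 0)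
    (y : Euc d) : Measure.QuasiMeasurePreserving (fun x => act A x - y) volume volume := by
  refine ⟨measurable_affine A y, ?_⟩
  rw [map_affine_volume hA]
  exact Measure.smul_absolutelyContinuous

theorem eLpNorm_comp_affine {d : ℕ} {A : Matrix (Fin d) (Fin d) ℝ} (hA : A.det ≠ 0) (y : Euc d)
    {f : Euc d → ℂ} (hf : AEStronglyMeasurable f volume) :
    eLpNorm (fun x => f (act A x - y)) 2 volume =
      ENNReal.ofReal |A.det|⁻¹ ^ (1 / 2 : ℝ) * eLpNorm f 2 volume := by
  have hm := map_affine_volume hA y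
  have h := eLpNorm_map_measure (p := 2) (μ := volume) (f := fun x => act A x - y) (g := f)
    (by rw [hm]; exact hf.smul_measure _) (measurable_affine A y).aemeasurable
  rw [hm, eLpNorm_smul_measure_of_ne_top (by norm_num)] at h
  simpa [Function.comp_def] using h.symm

theorem memLp_comp_affine {d : ℕ} {A : Matrix (Fin d) (Fin d) ℝ} (hA : A.det ≠ 0) (y : Euc d)
    {f : Euc d → ℂ} (hf : MemLp f 2 volume) : MemLp (fun x => f (act A x - y)) 2 volume := by
  refine ⟨hf.1.comp_quasiMeasurePreserving (quasiMeasurePreserving_affine hA y), ?_⟩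
  rw [eLpNorm_comp_affine hA y hf.1]
  exact ENNReal.mul_lt_top (ENNReal.rpow_lt_top_of_nonneg (by norm_num) ENNReal.ofReal_ne_top) hf.2

/-- The weight is the character `e^{-2πi η·x}`, of modulus one. -/
theorem memLp_modulate {d : ℕ} (η : Euc d) {f : Euc d → ℂ} (hf : MemLp f 2 volume) :
    MemLp (fun x => (Real.fourierChar (-inner ℝ η x) : ℂ) * f x) 2 volume := by
  refine hf.of_le (((by fun_prop : Continuous fun x : Euc d =>
    (Real.fourierChar (-inner ℝ η x) : ℂ))).aestronglyMeasurable.mul hf.1)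
    (Filter.Eventually.of_forall fun x => by
      rw [norm_mul, Circle.norm_coe, one_mul])

/-- The bounded operator `f ↦ e^{-2πi η·x} f(A x - y)` on `L₂(ℝ^d)`, for `A` invertible. The
character is part of it because the Fourier transform exchanges translations and modulations. -/
noncomputable def affinePullback {d : ℕ} {A : Matrix (Fin d) (Fin d) ℝ} (hA : A.det ≠ 0)
    (y η : Euc d) : L2 d →L[ℂ] L2 d :=
  LinearMap.mkContinuous
    { toFun := fun f => (memLp_modulate η (memLp_comp_affine hA y (Lp.memLp f))).toLp
      map_add' := fun f g => by
        rw [← MemLp.toLp_add]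
        refine MemLp.toLp_congr _ _ ?_
        filter_upwards [(quasiMeasurePreserving_affine hA y).ae (Lp.coeFn_add f g)] with x hx
        simp only [hx, Pi.add_apply, mul_add]
      map_smul' := fun c f => by
        rw [RingHom.id_apply, ← MemLp.toLp_const_smul]
        refine MemLp.toLp_congr _ _ ?_
        filter_upwards [(quasiMeasurePreserving_affine hA y).ae (Lp.coeFn_smul c f)] with x hx
        simp only [hx, Pi.smul_apply, smul_eq_mul]
        ring }
    ((ENNReal.ofReal |A.det|⁻¹ ^ (1 / 2 : ℝ)).toReal) (fun f => by
      change ‖(memLp_modulate η (memLp_comp_affine hA y (Lp.memLp f))).toLp‖ ≤ _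
      rw [Lp.norm_toLp, Lp.norm_def, ← ENNReal.toReal_mul,
        ← eLpNorm_comp_affine hA y (Lp.aestronglyMeasurable f)]
      refine ENNReal.toReal_mono (memLp_comp_affine hA y (Lp.memLp f)).2.ne
        (eLpNorm_mono fun x => ?_)
      rw [norm_mul, Circle.norm_coe, one_mul])

theorem coeFn_affinePullback {d : ℕ} {A : Matrix (Fin d) (Fin d) ℝ} (hA : A.det ≠ 0)
    (y η : Euc d) (f : L2 d) : affinePullback hA y η f =ᵐ[volume]
      fun x => (Real.fourierChar (-inner ℝ η x) : ℂ) * f (act A x - y) :=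
  (memLp_modulate η (memLp_comp_affine hA y (Lp.memLp f))).coeFn_toLp

theorem integral_comp_affine {d : ℕ} {A : Matrix (Fin d) (Fin d) ℝ} (hA : A.det ≠ 0) (y : Euc d)
    {G : Euc d → ℂ} (hG : Continuous G) :
    ∫ x, G (act A x - y) = (|A.det|⁻¹ : ℝ) • ∫ x, G x := by
  have hm := map_affine_volume hA y
  have h := integral_map (μ := volume) (φ := fun x => act A x - y) (f := G)
    (measurable_affine A y).aemeasurable hG.aestronglyMeasurable
  rw [hm, integral_smul_measure, ENNReal.toReal_ofReal (by positivity)] at h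
  exact h.symm

/-- The Fourier transform of an affine pullback, for the Fourier integral. -/
theorem fourier_comp_affine {d : ℕ} {A : Matrix (Fin d) (Fin d) ℝ} (hA : A.det ≠ 0) (y : Euc d)
    {f : Euc d → ℂ} (hf : Continuous f) (ξ : Euc d) :
    𝓕 (fun x => f (act A x - y)) ξ = ((|A.det|⁻¹ : ℝ) : ℂ) *
      ((Real.fourierChar (-inner ℝ (act A⁻¹ y) ξ) : ℂ) * 𝓕 f (act (A⁻¹)ᵀ ξ)) := by
  have hinv : ∀ x, act A⁻¹ (act A x - y + y) = x := fun x => by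
    rw [sub_add_cancel, ← act_mul, Matrix.nonsing_inv_mul _ (isUnit_iff_ne_zero.mpr hA), act_one]
  -- the integrand of `𝓕 (f (A · - y))`, as a function of `u = A x - y`
  have h := integral_comp_affine hA y
    (G := fun u => (Real.fourierChar (-inner ℝ (act A⁻¹ (u + y)) ξ) : ℂ) * f u) (by
      have := continuous_act A⁻¹
      fun_prop)
  simp only [hinv] at h
  rw [Real.fourier_eq, Real.fourier_eq]
  simp only [Circle.smul_def, smul_eq_mul]
  rw [h, Complex.real_smul]
  congr 1
  rw [← integral_const_mul]
  refine integral_congr_ae (Filter.Eventually.of_forall fun u => ?_)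
  beta_reduce
  rw [← mul_assoc]
  congr 1
  rw [← Circle.coe_mul, ← AddChar.map_add_eq_mul, ← inner_act_left]
  congr 2
  have : act A⁻¹ (u + y) = act A⁻¹ u + act A⁻¹ y := map_add _ _ _
  rw [this, inner_add_left]; ring

theorem det_inv_transpose_ne_zero {d : ℕ} {A : Matrix (Fin d) (Fin d) ℝ} (hA : A.det ≠ 0) :
    ((A⁻¹)ᵀ).det ≠ 0 := by
  simpa [Matrix.det_nonsing_inv, Ring.inverse_eq_inv'] using hA

/-- The Fourier transform of an affine pullback on `L₂(ℝ^d)`. Both sides are continuous in `f`, and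
they agree on the dense subspace of Schwartz functions. -/
theorem fourier_affinePullback {d : ℕ} {A : Matrix (Fin d) (Fin d) ℝ} (hA : A.det ≠ 0)
    (y : Euc d) (f : L2 d) :
    (𝓕 (affinePullback hA y 0 f) : L2 d) = ((|A.det|⁻¹ : ℝ) : ℂ) •
      affinePullback (det_inv_transpose_ne_zero hA) 0 (act A⁻¹ y) (𝓕 f : L2 d) := by
  refine DenseRange.induction_on
    (p := fun f : L2 d => (𝓕 (affinePullback hA y 0 f) : L2 d) = ((|A.det|⁻¹ : ℝ) : ℂ) •
      affinePullback (det_inv_transpose_ne_zero hA) 0 (act A⁻¹ y) (𝓕 f : L2 d))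
    (SchwartzMap.denseRange_toLpCLM (F := ℂ) (p := 2) ENNReal.ofNat_ne_top) f ?_ ?_
  · refine isClosed_eq ?_ ?_
    · exact (Lp.fourierTransformₗᵢ (Euc d) ℂ).continuous.comp (affinePullback hA y 0).continuous
    · exact ((((|A.det|⁻¹ : ℝ) : ℂ) • affinePullback (det_inv_transpose_ne_zero hA) 0
        (act A⁻¹ y)).continuous.comp (Lp.fourierTransformₗᵢ (Euc d) ℂ).continuous)
  intro f
  rw [SchwartzMap.toLpCLM_apply]
  let e : Euc d ≃L[ℝ] Euc d := (LinearMap.equivOfDetNeZero (Matrix.toEuclideanLin A)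
    (by rwa [det_toEuclideanLin])).toContinuousLinearEquiv
  let g : SchwartzMap (Euc d) ℂ :=
    SchwartzMap.compCLMOfContinuousLinearEquiv ℂ e (SchwartzMap.compSubConstCLM ℂ y f)
  have hg : ⇑g = fun x => f (act A x - y) := rfl
  have h1 : affinePullback hA y 0 (f.toLp 2) = g.toLp 2 := by
    refine Lp.ext ?_
    filter_upwards [coeFn_affinePullback hA y 0 (f.toLp 2), g.coeFn_toLp 2 volume,
      (quasiMeasurePreserving_affine hA y).ae (f.coeFn_toLp 2 volume)] with x h1 h2 h3
    rw [h1, h2, h3, hg]; simp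
  rw [h1, SchwartzMap.toLp_fourier_eq, SchwartzMap.toLp_fourier_eq]
  refine Lp.ext ?_
  filter_upwards [(𝓕 g).coeFn_toLp 2 volume, Lp.coeFn_smul ((|A.det|⁻¹ : ℝ) : ℂ)
      (affinePullback (det_inv_transpose_ne_zero hA) 0 (act A⁻¹ y) ((𝓕 f).toLp 2)),
    coeFn_affinePullback (det_inv_transpose_ne_zero hA) 0 (act A⁻¹ y) ((𝓕 f).toLp 2),
    (quasiMeasurePreserving_affine (det_inv_transpose_ne_zero hA) 0).ae
      ((𝓕 f).coeFn_toLp 2 volume)] with ξ h1 h2 h3 h4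
  rw [h1, h2, Pi.smul_apply, h3, h4, SchwartzMap.fourier_coe, SchwartzMap.fourier_coe, hg,
    fourier_comp_affine hA y f.continuous, smul_eq_mul, sub_zero]

/-! ### The two-scale relation in the space domain -/

theorem det_realMat {d : ℕ} (M : Matrix (Fin d) (Fin d) ℤ) : (realMat M).det = M.det :=
  ((Int.castRingHom ℝ).map_det M).symm

theorem absDet_eq {d : ℕ} (M : Matrix (Fin d) (Fin d) ℤ) : absDet M = |(realMat M).det| := by
  rw [det_realMat, absDet]

theorem det_realMat_ne_zero {d : ℕ} {M : Matrix (Fin d) (Fin d) ℤ} (hM : M.det ≠ 0) :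
    (realMat M).det ≠ 0 := by
  rw [det_realMat]; exact_mod_cast hM

theorem latPt_mulVec {d : ℕ} (M : Matrix (Fin d) (Fin d) ℤ) (k : Lat d) :
    latPt (M *ᵥ k) = act (realMat M) (latPt k) := by
  ext i
  simp [latPt, act, realMat, Matrix.toLpLin_apply, mulVec, dotProduct]

theorem latPt_add {d : ℕ} (k m : Lat d) : latPt (k + m) = latPt k + latPt m := by
  ext i; simp [latPt]

/-- The two-scale relation `g(x) = |det M₀| ∑_k b(k) φ(M₀ x - k)` in the space domain. -/
def TwoScale {d t r : ℕ} (M₀ : Matrix (Fin d) (Fin d) ℤ) (b : MFilter d t r)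
    (φ : Fin r → L2 d) (g : Fin t → L2 d) : Prop :=
  ∀ p, g p =ᵐ[volume] fun x => (absDet M₀ : ℂ) * ∑ k ∈ b.support, ∑ q,
    b k p q * φ q (act (realMat M₀) x - latPt k)

theorem IsRefinable.twoScale {d r : ℕ} {M₀ : Matrix (Fin d) (Fin d) ℤ} {b₀ : MFilter d r r}
    {φ : Fin r → L2 d} (h : IsRefinable M₀ b₀ φ) : TwoScale M₀ b₀ φ φ := by
  intro p
  filter_upwards [h] with x hx
  have := congrFun hx p
  simpa [Finsupp.sum, Finset.sum_apply, mulVec, dotProduct] using this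

/-- The exponential of `symbol` at `2π ξ` is Mathlib's character at `ξ`. -/
theorem fourierChar_latPt {d : ℕ} (k : Lat d) (ξ : Euc d) :
    (Real.fourierChar (-inner ℝ (latPt k) ξ) : ℂ) =
      Complex.exp (-Complex.I * ∑ i, (k i : ℂ) * (((2 * Real.pi) • ξ) i : ℂ)) := by
  rw [Real.fourierChar_apply]
  congr 1
  simp only [PiLp.inner_apply, latPt, RCLike.inner_apply, conj_trivial, PiLp.smul_apply,
    smul_eq_mul]
  push_cast
  simp only [mul_neg, Finset.mul_sum, Finset.sum_mul, neg_mul]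
  rw [← Finset.sum_neg_distrib]
  exact Finset.sum_congr rfl fun i _ => by ring

/-- The generators satisfy the two-scale relation: the right-hand side `G` of that relation has the
Fourier transform by which the generator is defined. -/
theorem twoScale_generator {d t r : ℕ} {M₀ : Matrix (Fin d) (Fin d) ℤ} (hM₀ : IsDilation M₀)
    (b : MFilter d t r) (φ : Fin r → L2 d) : TwoScale M₀ b φ (generator hM₀ b φ) := by
  intro p
  have hA : (realMat M₀).det ≠ 0 := det_realMat_ne_zero hM₀.det_ne_zero
  let G : L2 d := (absDet M₀ : ℂ) • ∑ k ∈ b.support, ∑ q,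
    b k p q • affinePullback hA (latPt k) 0 (φ q)
  have hs : ((|(realMat M₀).det| : ℝ) : ℂ) * ((|(realMat M₀).det|⁻¹ : ℝ) : ℂ) = 1 := by
    rw [← Complex.ofReal_mul, mul_inv_cancel₀ (abs_ne_zero.mpr hA), Complex.ofReal_one]
  have hFG : (𝓕 G : L2 d) = ∑ k ∈ b.support, ∑ q, b k p q •
      affinePullback (det_inv_transpose_ne_zero hA) 0 (act (realMat M₀)⁻¹ (latPt k))
        (𝓕 (φ q) : L2 d) := by
    have h0 : ∀ f : L2 d, (𝓕 f : L2 d) = Lp.fourierTransformₗᵢ (Euc d) ℂ f := fun _ => rfl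
    rw [h0, map_smul, map_sum, Finset.smul_sum]
    refine Finset.sum_congr rfl fun k _ => ?_
    rw [map_sum, Finset.smul_sum]
    refine Finset.sum_congr rfl fun q _ => ?_
    rw [map_smul, ← h0, fourier_affinePullback, smul_comm, smul_smul, smul_smul, absDet_eq,
      mul_assoc, hs, mul_one]
  have hmask : (𝓕 G : L2 d) = (memLp_maskedFourier hM₀ b φ p).toLp := by
    refine Lp.ext ?_
    rw [hFG]
    have hae : ∀ k q, (b k p q • affinePullback (det_inv_transpose_ne_zero hA) 0
        (act (realMat M₀)⁻¹ (latPt k)) (𝓕 (φ q) : L2 d) : L2 d) =ᵐ[volume] fun ξ =>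
        b k p q * ((Real.fourierChar (-inner ℝ (act (realMat M₀)⁻¹ (latPt k)) ξ) : ℂ) *
          (𝓕 (φ q) : L2 d) (act ((realMat M₀)⁻¹)ᵀ ξ)) := fun k q => by
      filter_upwards [Lp.coeFn_smul (b k p q) (affinePullback (det_inv_transpose_ne_zero hA) 0
        (act (realMat M₀)⁻¹ (latPt k)) (𝓕 (φ q) : L2 d)),
        coeFn_affinePullback (det_inv_transpose_ne_zero hA) 0
        (act (realMat M₀)⁻¹ (latPt k)) (𝓕 (φ q) : L2 d)] with ξ h1 h2
      rw [h1, Pi.smul_apply, h2, smul_eq_mul, sub_zero]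
    have hae' : ∀ᵐ ξ : Euc d, ∀ k ∈ b.support, ∀ q, (b k p q •
        affinePullback (det_inv_transpose_ne_zero hA) 0
        (act (realMat M₀)⁻¹ (latPt k)) (𝓕 (φ q) : L2 d) : L2 d) ξ =
        b k p q * ((Real.fourierChar (-inner ℝ (act (realMat M₀)⁻¹ (latPt k)) ξ) : ℂ) *
          (𝓕 (φ q) : L2 d) (act ((realMat M₀)⁻¹)ᵀ ξ)) :=
      (Filter.eventually_all_finset _).mpr fun k _ => ae_all_iff.mpr fun q => hae k q
    have hsum : ∀ᵐ ξ : Euc d, ∀ k ∈ b.support, ∀ (_ : Unit), (∑ q, b k p q •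
        affinePullback (det_inv_transpose_ne_zero hA) 0
        (act (realMat M₀)⁻¹ (latPt k)) (𝓕 (φ q) : L2 d) : L2 d) ξ =
        ∑ q, (b k p q • affinePullback (det_inv_transpose_ne_zero hA) 0
        (act (realMat M₀)⁻¹ (latPt k)) (𝓕 (φ q) : L2 d) : L2 d) ξ :=
      (Filter.eventually_all_finset _).mpr fun k _ => ae_all_iff.mpr fun _ =>
        Lp.coeFn_fun_finsetSum _ _
    filter_upwards [(memLp_maskedFourier hM₀ b φ p).coeFn_toLp, hae', hsum,
      Lp.coeFn_fun_finsetSum b.support fun k => (∑ q, b k p q •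
        affinePullback (det_inv_transpose_ne_zero hA) 0
        (act (realMat M₀)⁻¹ (latPt k)) (𝓕 (φ q) : L2 d) : L2 d)] with ξ h1 h2 h3 h4
    rw [h1, h4]
    have hpi : (2 * Real.pi)⁻¹ • (2 * Real.pi) • act ((realMat M₀)⁻¹)ᵀ ξ =
        act ((realMat M₀)⁻¹)ᵀ ξ := by
      rw [smul_smul, inv_mul_cancel₀ (by positivity), one_smul]
    have hact : act ((realMat M₀)⁻¹)ᵀ ((2 * Real.pi) • ξ) =
        (2 * Real.pi) • act ((realMat M₀)⁻¹)ᵀ ξ := map_smul _ _ _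
    simp only [maskedFourier, fourierL2, hact, hpi, symbol, mulVec, dotProduct, Finsupp.sum,
      Matrix.sum_apply, Matrix.smul_apply, smul_eq_mul, Finset.sum_mul]
    rw [Finset.sum_comm]
    refine Finset.sum_congr rfl fun k hk => ?_
    rw [h3 k hk ()]
    refine Finset.sum_congr rfl fun q _ => ?_
    rw [h2 k hk q, inner_act_left, fourierChar_latPt]
    ring
  have hgen : generator hM₀ b φ p = G := by
    rw [generator, ← hmask, FourierTransform.fourierInv_fourier_eq]
  rw [hgen]
  have hae : ∀ᵐ x : Euc d, ∀ k ∈ b.support, ∀ q, (b k p q •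
      affinePullback hA (latPt k) 0 (φ q) : L2 d) x =
      b k p q * φ q (act (realMat M₀) x - latPt k) :=
    (Filter.eventually_all_finset _).mpr fun k _ => ae_all_iff.mpr fun q => by
      filter_upwards [Lp.coeFn_smul (b k p q) (affinePullback hA (latPt k) 0 (φ q)),
        coeFn_affinePullback hA (latPt k) 0 (φ q)] with x h1 h2
      rw [h1, Pi.smul_apply, h2]; simp
  have hsum : ∀ᵐ x : Euc d, ∀ k ∈ b.support, ∀ (_ : Unit), (∑ q, b k p q •
      affinePullback hA (latPt k) 0 (φ q) : L2 d) x =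
      ∑ q, (b k p q • affinePullback hA (latPt k) 0 (φ q) : L2 d) x :=
    (Filter.eventually_all_finset _).mpr fun k _ => ae_all_iff.mpr fun _ =>
      Lp.coeFn_fun_finsetSum _ _
  filter_upwards [hae, hsum, Lp.coeFn_smul (absDet M₀ : ℂ) (∑ k ∈ b.support, ∑ q, b k p q •
      affinePullback hA (latPt k) 0 (φ q) : L2 d), Lp.coeFn_fun_finsetSum b.support fun k =>
      (∑ q, b k p q • affinePullback hA (latPt k) 0 (φ q) : L2 d)] with x h1 h2 h3 h4
  rw [h3, Pi.smul_apply, h4, smul_eq_mul]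
  congr 1
  refine Finset.sum_congr rfl fun k hk => ?_
  rw [h2 k hk ()]
  exact Finset.sum_congr rfl fun q _ => h1 k hk q

/-! ### Coefficients at consecutive levels -/

/-- The sum in the transition operator, indexed by the support of the filter. -/
theorem transition_apply {d s t r : ℕ} (b : MFilter d t r) (M : Matrix (Fin d) (Fin d) ℤ)
    (u : MSeq d s r) (n : Lat d) : transition b M u n =
      (Real.sqrt (absDet M) : ℂ) • ∑ m ∈ b.support, u (m + M *ᵥ n) * (b m)ᴴ := by
  rw [transition, ← finsum_comp_equiv (Equiv.addRight (M *ᵥ n))]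
  simp only [Equiv.coe_addRight, add_sub_cancel_right]
  rw [finsum_eq_sum_of_support_subset]
  intro m hm
  simp only [Function.mem_support, Finset.mem_coe, Finsupp.mem_support_iff] at hm ⊢
  intro h
  simp [h] at hm

theorem memLp_affineAtom {d : ℕ} {M₀ : Matrix (Fin d) (Fin d) ℤ} (hM₀ : M₀.det ≠ 0)
    (M : Matrix (Fin d) (Fin d) ℤ) (g : L2 d) (j : ℕ) (k : Lat d) :
    MemLp (affineAtom M₀ M g j k) 2 volume := by
  have hA : (realMat M₀ ^ j).det ≠ 0 := by
    rw [det_pow]; exact pow_ne_zero _ (det_realMat_ne_zero hM₀)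
  exact ((memLp_comp_affine hA _ (Lp.memLp g)).const_mul _).const_mul _

/-- For `M = M₀` the translation `M₀⁻¹ M k` is `k` and the factor `|det (M₀⁻¹ M)|^{1/2}` is one. -/
theorem affineAtom_lowpass {d : ℕ} {M₀ : Matrix (Fin d) (Fin d) ℤ} (hM₀ : M₀.det ≠ 0)
    (g : Euc d → ℂ) (j : ℕ) (k : Lat d) (x : Euc d) : affineAtom M₀ M₀ g j k x =
      (Real.sqrt (absDet M₀ ^ j) : ℂ) * g (act (realMat M₀ ^ j) x - latPt k) := by
  have hA : (realMat M₀).det ≠ 0 := det_realMat_ne_zero hM₀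
  rw [affineAtom, dilate, Matrix.nonsing_inv_mul _ (isUnit_iff_ne_zero.mpr hA), act_one, det_pow,
    abs_pow, ← absDet_eq]
  simp

/-- The two-scale relation, dilated by `M₀^j` and translated by `M₀⁻¹ M k`: an atom of `g` at level
`j` is a finite combination of the low-pass atoms of `φ` at level `j + 1`. -/
theorem TwoScale.affineAtom_eq {d t r : ℕ} {M₀ : Matrix (Fin d) (Fin d) ℤ} (hM₀ : M₀.det ≠ 0)
    {b : MFilter d t r} {φ : Fin r → L2 d} {g : Fin t → L2 d} (h : TwoScale M₀ b φ g)
    (M : Matrix (Fin d) (Fin d) ℤ) (p : Fin t) (j : ℕ) (k : Lat d) :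
    affineAtom M₀ M (g p) j k =ᵐ[volume] fun x => (Real.sqrt (absDet M) : ℂ) *
      ∑ n ∈ b.support, ∑ q, b n p q * affineAtom M₀ M₀ (φ q) (j + 1) (n + M *ᵥ k) x := by
  have hA : (realMat M₀).det ≠ 0 := det_realMat_ne_zero hM₀
  have hAj : (realMat M₀ ^ j).det ≠ 0 := by rw [det_pow]; exact pow_ne_zero _ hA
  filter_upwards [(quasiMeasurePreserving_affine hAj
    (act ((realMat M₀)⁻¹ * realMat M) (latPt k))).ae (h p)] with x hx
  -- `M₀ (M₀^j x - M₀⁻¹ M k) - n = M₀^{j+1} x - (n + M k)`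
  have hpt : ∀ n : Lat d, act (realMat M₀) (act (realMat M₀ ^ j) x -
      act ((realMat M₀)⁻¹ * realMat M) (latPt k)) - latPt n =
      act (realMat M₀ ^ (j + 1)) x - latPt (n + M *ᵥ k) := fun n => by
    have hsub : ∀ u v : Euc d, act (realMat M₀) (u - v) = act (realMat M₀) u -
      act (realMat M₀) v := fun u v => map_sub _ _ _
    rw [hsub, ← act_mul, ← act_mul, ← mul_assoc,
      Matrix.mul_nonsing_inv _ (isUnit_iff_ne_zero.mpr hA), one_mul, ← pow_succ', latPt_add,
      latPt_mulVec]
    abel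
  -- the normalizing factors of the two levels
  have hsc : Real.sqrt |((realMat M₀)⁻¹ * realMat M).det| * Real.sqrt |(realMat M₀ ^ j).det| *
      absDet M₀ = Real.sqrt (absDet M) * Real.sqrt (absDet M₀ ^ (j + 1)) := by
    have h0 : 0 < absDet M₀ := by rw [absDet_eq]; exact abs_pos.mpr hA
    rw [det_mul, Matrix.det_nonsing_inv, Ring.inverse_eq_inv', abs_mul, abs_inv, det_pow, abs_pow,
      ← absDet_eq, ← absDet_eq, Real.sqrt_mul (by positivity), Real.sqrt_inv, pow_succ,
      Real.sqrt_mul (by positivity)]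
    have hs : Real.sqrt (absDet M₀) ≠ 0 := (Real.sqrt_pos.mpr h0).ne'
    field_simp
    rw [Real.sq_sqrt h0.le, mul_comm]
  have hsc' := congrArg (fun z : ℝ => (z : ℂ)) hsc
  push_cast at hsc'
  simp only [affineAtom_lowpass hM₀]
  rw [affineAtom, dilate, hx]
  simp only [hpt]
  rw [← mul_assoc, ← mul_assoc, hsc', mul_assoc, Finset.mul_sum]
  congr 1
  refine Finset.sum_congr rfl fun n _ => ?_
  rw [Finset.mul_sum]
  exact Finset.sum_congr rfl fun q _ => by ring

theorem integrable_mul_conj {d : ℕ} {f g : Euc d → ℂ} (hf : MemLp f 2 volume)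
    (hg : MemLp g 2 volume) : Integrable fun x => f x * conj (g x) :=
  hf.integrable_mul (q := 2) hg.star

/-- The transition operator of `b` and `M` leads from the low-pass coefficients at level `j + 1` to
the coefficients against `g` at level `j`. -/
theorem TwoScale.affineCoeff_eq {d t r : ℕ} {M₀ : Matrix (Fin d) (Fin d) ℤ} (hM₀ : M₀.det ≠ 0)
    {b : MFilter d t r} {φ : Fin r → L2 d} {g : Fin t → L2 d} (h : TwoScale M₀ b φ g)
    (M : Matrix (Fin d) (Fin d) ℤ) (f : L2 d) (j : ℕ) :
    affineCoeff M₀ M g f j = transition b M (affineCoeff M₀ M₀ φ f (j + 1)) := by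
  funext k
  rw [transition_apply]
  ext i p
  simp only [affineCoeff, Matrix.of_apply, Matrix.smul_apply, Matrix.sum_apply, Matrix.mul_apply,
    Matrix.conjTranspose_apply, smul_eq_mul]
  have hint : ∀ q m, Integrable fun x => f x * conj (affineAtom M₀ M₀ (φ q) (j + 1) m x) :=
    fun q m => integrable_mul_conj (Lp.memLp f) (memLp_affineAtom hM₀ _ _ _ _)
  have h1 : pairing f (affineAtom M₀ M (g p) j k) = ∫ x, (Real.sqrt (absDet M) : ℂ) *
      ∑ n ∈ b.support, ∑ q, conj (b n p q) *
        (f x * conj (affineAtom M₀ M₀ (φ q) (j + 1) (n + M *ᵥ k) x)) := by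
    refine integral_congr_ae ?_
    filter_upwards [h.affineAtom_eq hM₀ M p j k] with x hx
    rw [hx]
    simp only [map_mul, map_sum, Complex.conj_ofReal, Finset.mul_sum]
    exact Finset.sum_congr rfl fun n _ => Finset.sum_congr rfl fun q _ => by ring
  rw [h1, integral_const_mul, integral_finsetSum _ fun n _ =>
    integrable_finsetSum _ fun q _ => (hint q _).const_mul _]
  congr 1
  refine Finset.sum_congr rfl fun n _ => ?_
  rw [integral_finsetSum _ fun q _ => (hint q _).const_mul _]
  refine Finset.sum_congr rfl fun q _ => ?_
  rw [integral_const_mul, mul_comm]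
  rfl

/-! ### Iterated transition operators and the filters of higher level -/

theorem mulVec_injective_of_det_ne_zero {d : ℕ} {N : Matrix (Fin d) (Fin d) ℤ} (hN : N.det ≠ 0) :
    Function.Injective fun m : Lat d => N *ᵥ m := by
  intro m m' h
  have h0 : N *ᵥ (m - m') = 0 := by rw [mulVec_sub]; exact sub_eq_zero.mpr h
  exact sub_eq_zero.mp (Matrix.eq_zero_of_mulVec_eq_zero hN h0)

theorem upsample_mulVec {d t r : ℕ} (u : MSeq d t r) {N : Matrix (Fin d) (Fin d) ℤ}
    (hN : N.det ≠ 0) (m : Lat d) : upsample u N (N *ᵥ m) = u m := by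
  have h : ∃ m', N *ᵥ m' = N *ᵥ m := ⟨m, rfl⟩
  rw [upsample, dif_pos h]
  exact congrArg u (mulVec_injective_of_det_ne_zero hN h.choose_spec)

theorem conv_upsample_apply {d s t r : ℕ} (b : MFilter d s t) {N : Matrix (Fin d) (Fin d) ℤ}
    (hN : N.det ≠ 0) (a : MSeq d t r) (x : Lat d) :
    conv (upsample b N) a x = ∑ m ∈ b.support, b m * a (x - N *ᵥ m) := by
  classical
  rw [conv, finsum_eq_sum_of_support_subset (s := b.support.image fun m => N *ᵥ m),
    Finset.sum_image fun m _ m' _ h => mulVec_injective_of_det_ne_zero hN h]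
  · exact Finset.sum_congr rfl fun m _ => by rw [upsample_mulVec _ hN]
  · intro k hk
    by_cases h : ∃ m, N *ᵥ m = k
    · obtain ⟨m, rfl⟩ := h
      rw [Function.mem_support, upsample_mulVec _ hN] at hk
      refine Finset.mem_coe.mpr (Finset.mem_image_of_mem _ (Finsupp.mem_support_iff.mpr fun h => ?_))
      simp [h] at hk
    · simp [upsample, h] at hk

theorem finite_support_conv_upsample {d s t r : ℕ} (b : MFilter d s t)
    {N : Matrix (Fin d) (Fin d) ℤ} (hN : N.det ≠ 0) {a : MSeq d t r}
    (ha : (Function.support a).Finite) : (Function.support (conv (upsample b N) a)).Finite := by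
  refine (b.support.finite_toSet.biUnion fun m _ => ha.image fun y => y + N *ᵥ m).subset ?_
  intro x hx
  rw [Function.mem_support, conv_upsample_apply b hN] at hx
  obtain ⟨m, hm, hne⟩ := Finset.exists_ne_zero_of_sum_ne_zero hx
  refine Set.mem_biUnion hm ⟨x - N *ᵥ m, fun h => hne ?_, sub_add_cancel _ _⟩
  rw [h, Matrix.mul_zero]

theorem det_pow_ne_zero {d : ℕ} {N : Matrix (Fin d) (Fin d) ℤ} (hN : N.det ≠ 0) (i : ℕ) :
    (N ^ i).det ≠ 0 := by
  rw [det_pow]; exact pow_ne_zero _ hN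

theorem finite_support_lowpassFilter {d r : ℕ} {M₀ : Matrix (Fin d) (Fin d) ℤ}
    (hM₀ : M₀.det ≠ 0) (b₀ : MFilter d r r) (i : ℕ) :
    (Function.support (lowpassFilter M₀ b₀ i)).Finite := by
  induction i with
  | zero =>
    refine (Set.finite_singleton (0 : Lat d)).subset fun k hk => ?_
    by_contra h
    exact hk (if_neg h)
  | succ i ih => exact finite_support_conv_upsample b₀ (det_pow_ne_zero hM₀ i) ih

theorem finite_support_mul_shift {d s t r : ℕ} (u : MSeq d s r) {a : MSeq d t r}
    (ha : (Function.support a).Finite) (y : Lat d) :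
    (Function.support fun k => u k * (a (k - y))ᴴ).Finite := by
  refine (ha.image fun k => k + y).subset fun k hk => ⟨k - y, fun h => hk ?_, sub_add_cancel _ _⟩
  simp [h]

/-- A transition operator applied to correlations with `a` on the lattice `N ℤ^d` yields
correlations with `(b ↑ N) * a` on the lattice `N M ℤ^d`. -/
theorem transition_correlation {d s t r r' : ℕ} (b : MFilter d t r)
    (M : Matrix (Fin d) (Fin d) ℤ) {N : Matrix (Fin d) (Fin d) ℤ} (hN : N.det ≠ 0)
    (u : MSeq d s r') {a : MSeq d r r'} (ha : (Function.support a).Finite) (α : ℂ) (n : Lat d) :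
    transition b M (fun m => α • ∑ᶠ k, u k * (a (k - N *ᵥ m))ᴴ) n =
      (α * Real.sqrt (absDet M)) •
        ∑ᶠ k, u k * (conv (upsample b N) a (k - (N * M) *ᵥ n))ᴴ := by
  have h1 : ∀ k, u k * (conv (upsample b N) a (k - (N * M) *ᵥ n))ᴴ =
      ∑ m ∈ b.support, (u k * (a (k - N *ᵥ (m + M *ᵥ n)))ᴴ) * (b m)ᴴ := fun k => by
    rw [conv_upsample_apply b hN, conjTranspose_sum, Matrix.mul_sum]
    refine Finset.sum_congr rfl fun m _ => ?_
    rw [conjTranspose_mul, Matrix.mul_assoc, mulVec_add, mulVec_mulVec, sub_sub, add_comm]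
  rw [transition_apply, finsum_congr h1, finsum_sum_comm, mul_comm, mul_smul]
  · congr 1
    rw [Finset.smul_sum]
    refine Finset.sum_congr rfl fun m _ => ?_
    rw [Matrix.smul_mul]
    congr 1
    exact AddMonoidHom.map_finsum
      ({ toFun := fun X => X * (b m)ᴴ, map_zero' := Matrix.zero_mul _,
         map_add' := fun X Y => Matrix.add_mul X Y _ } : Matrix (Fin s) (Fin r) ℂ →+ _)
      (finite_support_mul_shift u ha _)
  · intro m _
    refine (finite_support_mul_shift u ha (N *ᵥ (m + M *ᵥ n))).subset fun k hk h => hk ?_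
    simp only at h
    simp [h]

/-- A sequence `w` of which each entry is the transition of the next one, iterated `i` times. -/
theorem eq_lowpass_correlation {d s r : ℕ} {M₀ : Matrix (Fin d) (Fin d) ℤ} (hM₀ : M₀.det ≠ 0)
    (b₀ : MFilter d r r) {w : ℕ → MSeq d s r} (hw : ∀ j, w j = transition b₀ M₀ (w (j + 1)))
    (i j : ℕ) : w j = fun k => ((Real.sqrt (absDet M₀) : ℂ) ^ i) •
      ∑ᶠ n, w (j + i) n * (lowpassFilter M₀ b₀ i (n - (M₀ ^ i) *ᵥ k))ᴴ := by
  induction i generalizing j with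
  | zero =>
    funext k
    rw [finsum_eq_single _ k]
    · simp [lowpassFilter, deltaSeq]
    · intro n hn
      simp [lowpassFilter, deltaSeq, sub_eq_zero, hn]
  | succ i ih =>
    rw [hw j, ih (j + 1)]
    funext k
    rw [transition_correlation b₀ M₀ (det_pow_ne_zero hM₀ i) _
      (finite_support_lowpassFilter hM₀ b₀ i), ← pow_succ, ← pow_succ, add_right_comm, add_assoc]
    rfl

/-- The last transition, with `b` and `M`, follows `J - j - 1` transitions with `b₀` and `M₀`;
together they are correlations with the discrete atoms of level `J - j`. -/
theorem transition_eq_seqInner {d s t r : ℕ} {M₀ : Matrix (Fin d) (Fin d) ℤ} (hM₀ : M₀.det ≠ 0)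
    (b₀ : MFilter d r r) {w : ℕ → MSeq d s r} (hw : ∀ j, w j = transition b₀ M₀ (w (j + 1)))
    (M : Matrix (Fin d) (Fin d) ℤ) (b : MFilter d t r) {J j : ℕ} (hj : j < J) (k : Lat d) :
    transition b M (w (j + 1)) k = seqInner (w J) (discreteAtom M₀ b₀ M b (J - j) k) := by
  obtain ⟨i, rfl⟩ : ∃ i, J = j + 1 + i := ⟨J - (j + 1), by omega⟩
  have hi : j + 1 + i - j - 1 = i := by omega
  have hfin := finite_support_lowpassFilter hM₀ b₀ i
  have hatom : ∀ n, w (j + 1 + i) n * (discreteAtom M₀ b₀ M b (j + 1 + i - j) k n)ᴴ =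
      ((Real.sqrt (absDet M₀) : ℂ) ^ i * Real.sqrt (absDet M)) • (w (j + 1 + i) n *
        (conv (upsample b (M₀ ^ i)) (lowpassFilter M₀ b₀ i) (n - (M₀ ^ i * M) *ᵥ k))ᴴ) := by
    intro n
    rw [discreteAtom, levelFilter, hi, conjTranspose_smul, Matrix.mul_smul]
    simp
  rw [eq_lowpass_correlation hM₀ b₀ hw i (j + 1),
    transition_correlation b M (det_pow_ne_zero hM₀ i) _ hfin, seqInner, tsum_congr hatom,
    tsum_const_smul'', tsum_eq_finsum]
  exact finite_support_mul_shift _ (finite_support_conv_upsample b (det_pow_ne_zero hM₀ i) hfin) _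

/-! ### Uniform square summability for compactly supported functions -/

/-- The Cauchy–Schwarz inequality, in which only the part of `f` over the support of `g` counts. -/
theorem enorm_pairing_sq_le {d : ℕ} {f g : Euc d → ℂ} (hf : AEStronglyMeasurable f volume)
    (hg : AEStronglyMeasurable g volume) {S : Set (Euc d)} (hS : MeasurableSet S)
    (hgS : ∀ᵐ x, x ∉ S → g x = 0) : ‖pairing f g‖ₑ ^ 2 ≤
      (∫⁻ x, ‖g x‖ₑ ^ 2) * ∫⁻ x, S.indicator 1 x * ‖f x‖ₑ ^ 2 := by
  have h1 : ‖pairing f g‖ₑ ≤ ∫⁻ x, ((fun x => ‖g x‖ₑ) * fun x => S.indicator 1 x * ‖f x‖ₑ) x := by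
    refine (enorm_integral_le_lintegral_enorm _).trans (lintegral_mono_ae ?_)
    filter_upwards [hgS] with x hx
    by_cases h : x ∈ S
    · simp [h, enorm_mul, mul_comm]
    · simp [hx h]
  have h2 := ENNReal.lintegral_mul_le_Lp_mul_Lq volume Real.HolderConjugate.two_two hg.enorm
    ((aemeasurable_const (b := (1 : ℝ≥0∞)) |>.indicator hS).mul hf.enorm)
  have h3 := pow_le_pow_left₀ zero_le (h1.trans h2) 2
  have hsq : ∀ a : ℝ≥0∞, (a ^ (1 / 2 : ℝ)) ^ 2 = a := fun a => by
    rw [← ENNReal.rpow_natCast, ← ENNReal.rpow_mul]; norm_num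
  rw [mul_pow, hsq, hsq] at h3
  refine h3.trans_eq ?_
  congr 1
  · exact lintegral_congr fun x => by rw [ENNReal.rpow_two]
  · refine lintegral_congr fun x => ?_
    rw [ENNReal.rpow_two]
    by_cases h : x ∈ S <;> simp [h]

/-- The translates of a compact set by lattice points have bounded overlap. -/
theorem exists_overlap_bound {d : ℕ} {K : Set (Euc d)} (hK : IsCompact K) :
    ∃ N : ℕ, ∀ y : Euc d, ∑' k : Lat d, K.indicator (1 : Euc d → ℝ≥0∞) (y - latPt k) ≤ N := by
  obtain ⟨R, hR⟩ := hK.isBounded.subset_closedBall 0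
  let S : Finset (Lat d) := Fintype.piFinset fun _ => Finset.Icc (-(⌈R⌉ + 1)) (⌈R⌉ + 1)
  refine ⟨S.card, fun y => ?_⟩
  rw [← (Equiv.addLeft (fun i => ⌊y i⌋ : Lat d)).tsum_eq]
  -- After the shift by `⌊y⌋` the point lies in the unit cube, so that only `m` with
  -- `|m_i| ≤ ⌈R⌉ + 1` contribute.
  have hout : ∀ m ∉ S, K.indicator (1 : Euc d → ℝ≥0∞)
      (y - latPt (Equiv.addLeft (fun i => ⌊y i⌋ : Lat d) m)) = 0 := by
    intro m hm
    refine Set.indicator_of_notMem (fun hmem => hm ?_) _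
    refine Fintype.mem_piFinset.mpr fun i => ?_
    have h1 := (PiLp.norm_apply_le _ i).trans (mem_closedBall_zero_iff.mp (hR hmem))
    have h2 : (y - latPt (Equiv.addLeft (fun i => ⌊y i⌋ : Lat d) m)) i =
        y i - (⌊y i⌋ + m i) := by simp [latPt]
    rw [h2, Real.norm_eq_abs, abs_le] at h1
    have h3 := Int.floor_le (y i)
    have h4 := Int.lt_floor_add_one (y i)
    have h5 := Int.le_ceil R
    rw [Finset.mem_Icc]
    constructor
    · have : (-(⌈R⌉ + 1) : ℝ) ≤ m i := by linarith [h1.2]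
      exact_mod_cast this
    · have : (m i : ℝ) ≤ ⌈R⌉ + 1 := by linarith [h1.1]
      exact_mod_cast this
  rw [tsum_eq_sum hout]
  refine (Finset.sum_le_card_nsmul _ _ 1 fun m _ => ?_).trans (by simp)
  exact Set.indicator_le_self' (f := (1 : Euc d → ℝ≥0∞)) (fun _ _ => zero_le) _

/-- The low-pass atoms are normalized: they all have the norm of `g`. -/
theorem lintegral_enorm_affineAtom {d : ℕ} {M₀ : Matrix (Fin d) (Fin d) ℤ} (hM₀ : M₀.det ≠ 0)
    (g : L2 d) (j : ℕ) (k : Lat d) :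
    ∫⁻ x, ‖affineAtom M₀ M₀ g j k x‖ₑ ^ 2 = ∫⁻ x, ‖g x‖ₑ ^ 2 := by
  have hA : (realMat M₀ ^ j).det ≠ 0 := by
    rw [det_pow]; exact pow_ne_zero _ (det_realMat_ne_zero hM₀)
  have hD : absDet M₀ ^ j = |(realMat M₀ ^ j).det| := by rw [det_pow, abs_pow, absDet_eq]
  have hm : Measurable fun x => ‖g x‖ₑ ^ 2 := (Lp.stronglyMeasurable g).enorm.pow_const 2
  have h := lintegral_map (μ := volume) hm (measurable_affine (realMat M₀ ^ j) (latPt k))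
  rw [map_affine_volume hA, lintegral_smul_measure] at h
  have hs : ‖(Real.sqrt (absDet M₀ ^ j) : ℂ)‖ₑ ^ 2 = ENNReal.ofReal |(realMat M₀ ^ j).det| := by
    rw [← hD, ← ofReal_norm, Complex.norm_real, Real.norm_of_nonneg (Real.sqrt_nonneg _),
      ← ENNReal.ofReal_pow (Real.sqrt_nonneg _), Real.sq_sqrt (hD ▸ abs_nonneg _)]
  simp only [affineAtom_lowpass hM₀, enorm_mul, mul_pow, hs]
  rw [lintegral_const_mul' _ _ ENNReal.ofReal_ne_top, ← h, smul_eq_mul, ← mul_assoc,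
    ← ENNReal.ofReal_mul (abs_nonneg _), mul_inv_cancel₀ (abs_ne_zero.mpr hA), ENNReal.ofReal_one,
    one_mul]

/-- The coefficients of `f` at any level `j` against a compactly supported function are square
summable, with a bound that does not depend on `j`. -/
theorem tsum_enorm_pairing_affineAtom_le {d : ℕ} {M₀ : Matrix (Fin d) (Fin d) ℤ}
    (hM₀ : M₀.det ≠ 0) {K : Set (Euc d)} (hK : IsCompact K) {N : ℕ}
    (hN : ∀ y : Euc d, ∑' k : Lat d, K.indicator (1 : Euc d → ℝ≥0∞) (y - latPt k) ≤ N)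
    {g : L2 d} (hg : ∀ᵐ x, x ∉ K → g x = 0) (f : L2 d) (j : ℕ) :
    ∑' k, ‖pairing f (affineAtom M₀ M₀ g j k)‖ₑ ^ 2 ≤
      (∫⁻ x, ‖g x‖ₑ ^ 2) * (N * ∫⁻ x, ‖f x‖ₑ ^ 2) := by
  have hA : (realMat M₀ ^ j).det ≠ 0 := by
    rw [det_pow]; exact pow_ne_zero _ (det_realMat_ne_zero hM₀)
  -- the atom with index `k` vanishes outside `S k`
  let S : Lat d → Set (Euc d) := fun k => (fun x => act (realMat M₀ ^ j) x - latPt k) ⁻¹' K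
  have hS : ∀ k, MeasurableSet (S k) := fun k => measurable_affine _ _ hK.measurableSet
  have hfm : Measurable fun x => ‖f x‖ₑ ^ 2 := (Lp.stronglyMeasurable f).enorm.pow_const 2
  have h1 : ∀ k, ‖pairing f (affineAtom M₀ M₀ g j k)‖ₑ ^ 2 ≤
      (∫⁻ x, ‖g x‖ₑ ^ 2) * ∫⁻ x, (S k).indicator 1 x * ‖f x‖ₑ ^ 2 := fun k => by
    rw [← lintegral_enorm_affineAtom hM₀ g j k]
    refine enorm_pairing_sq_le (Lp.aestronglyMeasurable f)
      (memLp_affineAtom hM₀ M₀ g j k).aestronglyMeasurable (hS k) ?_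
    filter_upwards [(quasiMeasurePreserving_affine hA (latPt k)).ae hg] with x hx hxS
    rw [affineAtom_lowpass hM₀, hx hxS, mul_zero]
  refine (ENNReal.tsum_le_tsum h1).trans ?_
  have hm : ∀ k, AEMeasurable (fun x => (S k).indicator 1 x * ‖f x‖ₑ ^ 2) volume := fun k =>
    ((measurable_one.indicator (hS k)).mul hfm).aemeasurable
  rw [ENNReal.tsum_mul_left, ← lintegral_tsum hm,
    ← lintegral_const_mul' _ _ (ENNReal.natCast_ne_top N)]
  gcongr with x
  rw [ENNReal.tsum_mul_right]
  gcongr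
  exact hN (act (realMat M₀ ^ j) x)

/-! ### The Bessel property of the affine system -/

theorem seqNormSq_affineCoeff {d t : ℕ} (M₀ M : Matrix (Fin d) (Fin d) ℤ) (ψ : Fin t → L2 d)
    (f : L2 d) (j : ℕ) : seqNormSq (affineCoeff M₀ M ψ f j) =
      ∑ q, ∑' k, ‖pairing f (affineAtom M₀ M (ψ q) j k)‖ₑ ^ 2 := by
  simp only [seqNormSq, affineCoeff, Matrix.of_apply, Fin.sum_univ_one]
  exact Summable.tsum_finsetSum fun _ _ => ENNReal.summable

theorem lintegral_enorm_sq_eq {d : ℕ} (f : L2 d) :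
    ∫⁻ x, ‖f x‖ₑ ^ 2 = ENNReal.ofReal (‖f‖ ^ 2) := by
  rw [ENNReal.ofReal_pow (norm_nonneg f), ofReal_norm, Lp.enorm_def,
    eLpNorm_eq_lintegral_rpow_enorm_toReal (by norm_num) (by norm_num), ← ENNReal.rpow_natCast,
    ← ENNReal.rpow_mul]
  norm_num

/-- Started from `w J`, the discrete low-pass data run through `w (J - 1), w (J - 2), …`. -/
theorem lowpassData_eq {d r : ℕ} {M₀ : Matrix (Fin d) (Fin d) ℤ} {b₀ : MFilter d r r}
    {w : ℕ → MSeq d 1 r} (hw : ∀ j, w j = transition b₀ M₀ (w (j + 1))) {J j : ℕ} (hj : j ≤ J) :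
    lowpassData M₀ b₀ (w J) j = w (J - j) := by
  induction j with
  | zero => rfl
  | succ j ih =>
    rw [lowpassData, ih (by omega), hw (J - (j + 1))]
    congr 2
    omega

/-- The energy of the `J`-level transform of `w J`. The transform numbers its levels from the finest
one downwards, the sum here from the coarsest one upwards. -/
theorem tupleNormSq_analysis {d r s : ℕ} {M₀ : Matrix (Fin d) (Fin d) ℤ}
    {M : Fin s → Matrix (Fin d) (Fin d) ℤ} {b₀ : MFilter d r r} {b : Fin s → MFilter d 1 r}
    {w : ℕ → MSeq d 1 r} (hw : ∀ j, w j = transition b₀ M₀ (w (j + 1))) (J : ℕ) :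
    tupleNormSq (analysis M₀ M b₀ b J (w J)) =
      (∑ j ∈ Finset.range J, ∑ l, seqNormSq (transition (b l) (M l) (w (j + 1)))) +
        seqNormSq (w 0) := by
  have hentry : ∀ (j : Fin J) (l : Fin s),
      transition (b l) (M l) (lowpassData M₀ b₀ (w J) j) =
        transition (b l) (M l) (w (J - 1 - j + 1)) := fun j l => by
    have h := j.2
    rw [lowpassData_eq hw h.le, show J - 1 - (j : ℕ) + 1 = J - j by omega]
  simp only [tupleNormSq, analysis, hentry]
  rw [lowpassData_eq hw le_rfl, Nat.sub_self, ← Finset.sum_range_reflect,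
    ← Fin.sum_univ_eq_sum_range
      (fun j => ∑ l, seqNormSq (transition (b l) (M l) (w (J - 1 - j + 1))))]

/-- The translates `ψ⁰_q(· - k)` are the low-pass atoms at level `0`. -/
theorem affineSystem_inl {d r s : ℕ} {M₀ : Matrix (Fin d) (Fin d) ℤ} (hM₀ : M₀.det ≠ 0)
    (M : Fin s → Matrix (Fin d) (Fin d) ℤ) (ψ₀ : Fin r → L2 d) (ψ : Fin s → Fin 1 → L2 d)
    (q : Fin r) (k : Lat d) :
    affineSystem M₀ M ψ₀ ψ (.inl (q, k)) = affineAtom M₀ M₀ (ψ₀ q) 0 k := by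
  funext x
  rw [affineAtom_lowpass hM₀]
  simp [affineSystem, act_one]

/-- Only the upper bound in the stability condition enters. -/
theorem isBessel_affineSystem {d r s : ℕ} {M₀ : Matrix (Fin d) (Fin d) ℤ}
    {M : Fin s → Matrix (Fin d) (Fin d) ℤ} (hM₀ : M₀.det ≠ 0) {b₀ : MFilter d r r}
    {b : Fin s → MFilter d 1 r} {ψ₀ : Fin r → L2 d} {ψ : Fin s → Fin 1 → L2 d}
    (h₀ : TwoScale M₀ b₀ ψ₀ ψ₀) (h : ∀ l, TwoScale M₀ (b l) ψ₀ (ψ l))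
    (hc : IsCompactlySupported ψ₀) (hs : HasStability M₀ M b₀ b) :
    IsBessel (affineSystem M₀ M ψ₀ ψ) := by
  obtain ⟨K, hK, hKψ⟩ := hc
  obtain ⟨N, hN⟩ := exists_overlap_bound hK
  obtain ⟨_, C₂, -, hC₂, hstab⟩ := hs
  let B : ℝ := ∑ q, ‖ψ₀ q‖ ^ 2 * N
  have hB : 0 ≤ B := Finset.sum_nonneg fun q _ => by positivity
  -- `C₂ B` bounds the translates and the atoms of the `ψ^l` separately; the summand `1` makes the
  -- constant positive also if `B = 0`
  refine ⟨?_, 2 * (C₂ * B) + 1, by positivity, fun f => ?_⟩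
  · rintro (⟨q, k⟩ | ⟨l, j, k⟩)
    · rw [affineSystem_inl hM₀]
      exact memLp_affineAtom hM₀ _ _ _ _
    · exact memLp_affineAtom hM₀ _ _ _ _
  let w : ℕ → MSeq d 1 r := affineCoeff M₀ M₀ ψ₀ f
  have hw : ∀ j, w j = transition b₀ M₀ (w (j + 1)) := fun j => h₀.affineCoeff_eq hM₀ M₀ f j
  have hwB : ∀ J, seqNormSq (w J) ≤ ENNReal.ofReal (B * ‖f‖ ^ 2) := fun J => by
    rw [seqNormSq_affineCoeff, Finset.sum_mul, ENNReal.ofReal_sum_of_nonneg fun q _ => by positivity]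
    refine Finset.sum_le_sum fun q _ => ?_
    refine (tsum_enorm_pairing_affineAtom_le hM₀ hK hN (hKψ q) f J).trans_eq ?_
    rw [lintegral_enorm_sq_eq, lintegral_enorm_sq_eq, mul_assoc,
      ENNReal.ofReal_mul (by positivity), ENNReal.ofReal_mul (by positivity), ENNReal.ofReal_natCast]
  have hJ : ∀ J, 1 ≤ J → (∑ j ∈ Finset.range J, ∑ l, seqNormSq (affineCoeff M₀ (M l) (ψ l) f j)) +
      seqNormSq (w 0) ≤ ENNReal.ofReal (C₂ * B * ‖f‖ ^ 2) := fun J hJ1 => by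
    have h1 := (hstab J hJ1 (w J) ((hwB J).trans_lt ENNReal.ofReal_lt_top)).2
    rw [tupleNormSq_analysis hw] at h1
    have h2 : ∀ j l, affineCoeff M₀ (M l) (ψ l) f j = transition (b l) (M l) (w (j + 1)) :=
      fun j l => (h l).affineCoeff_eq hM₀ (M l) f j
    simp only [h2]
    refine h1.trans ?_
    rw [mul_assoc, ENNReal.ofReal_mul hC₂.le]
    gcongr
    exact hwB J
  have hinl : ∑' i, ‖pairing f (affineSystem M₀ M ψ₀ ψ (.inl i))‖ₑ ^ 2 ≤
      ENNReal.ofReal (C₂ * B * ‖f‖ ^ 2) := by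
    refine le_trans (le_of_eq ?_) (le_add_self.trans (hJ 1 le_rfl))
    rw [ENNReal.tsum_prod', tsum_fintype, seqNormSq_affineCoeff]
    simp only [affineSystem_inl hM₀]
  have hinr : ∑' i, ‖pairing f (affineSystem M₀ M ψ₀ ψ (.inr i))‖ₑ ^ 2 ≤
      ENNReal.ofReal (C₂ * B * ‖f‖ ^ 2) := by
    have heq : ∑' i, ‖pairing f (affineSystem M₀ M ψ₀ ψ (.inr i))‖ₑ ^ 2 =
        ∑' j, ∑ l, seqNormSq (affineCoeff M₀ (M l) (ψ l) f j) := by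
      rw [ENNReal.tsum_prod', tsum_fintype, Summable.tsum_finsetSum fun _ _ => ENNReal.summable]
      refine Finset.sum_congr rfl fun l _ => ?_
      rw [ENNReal.tsum_prod']
      refine tsum_congr fun j => ?_
      rw [seqNormSq_affineCoeff, Fin.sum_univ_one]
      rfl
    rw [heq]
    refine ENNReal.tsum_le_of_sum_range_le fun J => ?_
    refine (Finset.sum_le_sum_of_subset (Finset.range_mono J.le_succ)).trans ?_
    exact le_self_add.trans (hJ (J + 1) (by omega))
  rw [Summable.tsum_sum ENNReal.summable ENNReal.summable]
  refine (add_le_add hinl hinr).trans ?_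
  rw [← ENNReal.ofReal_add (by positivity) (by positivity)]
  refine ENNReal.ofReal_le_ofReal ?_
  nlinarith [sq_nonneg ‖f‖]

end MixedFramelet

theorem mainTheorem9 {d r s : ℕ}
    (M₀ : Matrix (Fin d) (Fin d) ℤ) (M : Fin s → Matrix (Fin d) (Fin d) ℤ)
    (hM₀ : MixedFramelet.IsDilation M₀) (hM : ∀ l, MixedFramelet.IsDilation (M l))
    (b₀ : MixedFramelet.MFilter d r r) (b : Fin s → MixedFramelet.MFilter d 1 r)
    (ψ₀ : Fin r → MixedFramelet.L2 d) (hψ₀ : MixedFramelet.IsRefinable M₀ b₀ ψ₀)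
    (ψ : Fin s → Fin 1 → MixedFramelet.L2 d)
    (hψ : ∀ l, ψ l = MixedFramelet.generator hM₀ (b l) ψ₀) :
    -- (i), for `l = 0` and for `l = 1, …, s`
    (∀ (f : MixedFramelet.L2 d) (j : ℕ) (k : MixedFramelet.Lat d),
      MixedFramelet.affineCoeff M₀ M₀ ψ₀ f j k =
        MixedFramelet.transition b₀ M₀ (MixedFramelet.affineCoeff M₀ M₀ ψ₀ f (j + 1)) k ∧
      ∀ l, MixedFramelet.affineCoeff M₀ (M l) (ψ l) f j k =
        MixedFramelet.transition (b l) (M l)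
          (MixedFramelet.affineCoeff M₀ M₀ ψ₀ f (j + 1)) k) ∧
    -- (ii), for `l = 0` and for `l = 1, …, s`
    (∀ (f : MixedFramelet.L2 d) (J j : ℕ), j < J → ∀ k : MixedFramelet.Lat d,
      MixedFramelet.affineCoeff M₀ M₀ ψ₀ f j k =
        MixedFramelet.seqInner (MixedFramelet.affineCoeff M₀ M₀ ψ₀ f J)
          (MixedFramelet.discreteAtom M₀ b₀ M₀ b₀ (J - j) k) ∧
      ∀ l, MixedFramelet.affineCoeff M₀ (M l) (ψ l) f j k =
        MixedFramelet.seqInner (MixedFramelet.affineCoeff M₀ M₀ ψ₀ f J)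
          (MixedFramelet.discreteAtom M₀ b₀ (M l) (b l) (J - j) k)) ∧
    -- (iii)
    (MixedFramelet.IsCompactlySupported ψ₀ → MixedFramelet.HasStability M₀ M b₀ b →
      MixedFramelet.IsBessel (MixedFramelet.affineSystem M₀ M ψ₀ ψ)) := by
  have hdet := hM₀.det_ne_zero
  have h₀ := hψ₀.twoScale
  have h : ∀ l, MixedFramelet.TwoScale M₀ (b l) ψ₀ (ψ l) := fun l =>
    hψ l ▸ MixedFramelet.twoScale_generator hM₀ (b l) ψ₀
  refine ⟨fun f j k => ⟨congrFun (h₀.affineCoeff_eq hdet M₀ f j) k, fun l =>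
      congrFun ((h l).affineCoeff_eq hdet (M l) f j) k⟩, fun f J j hj k => ?_,
    MixedFramelet.isBessel_affineSystem hdet h₀ h⟩
  have hw := fun j => h₀.affineCoeff_eq hdet M₀ f j
  refine ⟨?_, fun l => ?_⟩
  · rw [hw j]
    exact MixedFramelet.transition_eq_seqInner hdet b₀ hw M₀ b₀ hj k
  · rw [(h l).affineCoeff_eq hdet (M l) f j]
    exact MixedFramelet.transition_eq_seqInner hdet b₀ hw (M l) (b l) hj k
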